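/- **Model.** Fix $p,p_r\in(0,1)$, $q=1-p$, $\delta\ge 2$, $P_{\max}>0$, and put $d_F=\log(4/q)/\log 2$ and $d_r=2\log(2/(1-p_r))/\log 2$. Assume $d_F>3$ and $d_r<d_F-1$. The *streets of level* $l\ge 0$ are the horizontal and vertical unit segments of the unit square at the coordinates $b2^{-(l+1)}$, $b=1,3,\dots,2^{l+1}-1$. The two streets of level $0$ form the *central cross*. For each integer $n$, the network consists of $n$ independent mobile nodes and, independently of them, of relays. Each mobile node is placed with one-dimensional density $(p/2)(q/2)^l$ on every street of level $l$. At each crossing of a vertical and a horizontal street of levels $v$ and $h$ there is a relay, independently for different crossings, exactly when a Poisson variable of mean $n\,p_r^2\left(\frac{1-p_r}{2}\right)^{h+v}$ is at least $1$. A *hop* joins two stations (mobile nodes or relays) on a common street that have no mobile node strictly between them. A station active on a street that contains $m$ mobile nodes has power $P_{\max}/m^{\delta}$ there ($P_{\max}$ if $m=0$); a relay may use both of its streets. A *path* is a finite nonempty sequence of stations in which consecutive ones are joined by hops. Its *maximum power* is the maximum of the powers of its stations, each taken on the street along which the station transmits (for the last station, on a street on which it lies). For $E>0$, let $G'_1(n,E)$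 be the set of mobile nodes from which there is a path of maximum power at most $E$ that ends at a station on the central cross and goes through at most one relay. **Theorem.** Let $\alpha<1$ and $M_n=n^{-\delta(1-\alpha)}P_{\max}$. There is a constant $C>0$, independent of $n$, such that with probability tending to $1$ as $n\to\infty$ the following holds simultaneously for all mobile nodes $u,v\in G'_1(n,M_n)$: the shortest path from $u$ to $v$ of maximum power at most $M_n$ exists and has at most $$C\,n^{1-\alpha/(d_F-1)}$$ hops; and if some path from $u$ to $v$ has maximum power strictly less than $M_n$, then the shortest such path also has at most $C\,n^{1-\alpha/(d_F-1)}$ hops. -/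

import Mathlib

open MeasureTheory ProbabilityTheory Filter Topology
open scoped ENNReal NNReal

noncomputable section

namespace Hyperfractal

/-! ### The support: streets and crossings in the unit square -/

/-- A dyadic coordinate: the `index`-th odd multiple of `2 ^ (-(level + 1))` in `(0, 1)`. -/
structure Line where
  level : ℕ
  index : Fin (2 ^ level)

/-- The coordinate `b * 2 ^ (-(level + 1))` with `b = 2 * index + 1`, so `b` runs over
`1, 3, …, 2 ^ (level + 1) - 1`. -/
def Line.offset (l : Line) : ℝ := (2 * ((l.index : ℕ) : ℝ) + 1) / 2 ^ (l.level + 1)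

/-- A street: a full horizontal or vertical unit segment at a dyadic coordinate. -/
structure Street where
  vertical : Bool
  line : Line

/-- The point with parameter `t` on the street `s`. -/
def Street.point (s : Street) (t : ℝ) : ℝ × ℝ :=
  if s.vertical then (s.line.offset, t) else (t, s.line.offset)

/-- The street as a subset of the plane. -/
def Street.carrier (s : Street) : Set (ℝ × ℝ) := s.point '' Set.Icc 0 1

/-- The set `𝒳_l`, the union of all streets of level `l`. -/
def supportLevel (l : ℕ) : Set (ℝ × ℝ) := ⋃ s : Street, ⋃ _ : s.line.level = l, s.carrier

/-- The central cross `𝒳_0`. -/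
def centralCross : Set (ℝ × ℝ) := supportLevel 0

/-- A crossing of a vertical street (at abscissa `v.offset`) and a horizontal street
(at ordinate `h.offset`). -/
structure Crossing where
  v : Line
  h : Line

/-- The position of a crossing. -/
def Crossing.point (c : Crossing) : ℝ × ℝ := (c.v.offset, c.h.offset)

/-! ### The random network -/

/-- The law of the position of one mobile node: on each street of level `l`, one-dimensional
Lebesgue measure times `(p / 2) * (q / 2) ^ l`, where `q = 1 - p`. -/
def nodeLaw (p : ℝ) : Measure (ℝ × ℝ) :=
  Measure.sum fun s : Street =>
    ENNReal.ofReal ((p / 2) * ((1 - p) / 2) ^ s.line.level) •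
      (volume.restrict (Set.Icc (0 : ℝ) 1)).map s.point

/-- The mean mass `ρ * pr ^ 2 * ((1 - pr) / 2) ^ (h + v)` of the auxiliary Poisson process at a
crossing of streets of levels `h` and `v`. -/
def relayIntensity (pr ρ : ℝ) (c : Crossing) : ℝ≥0 :=
  Real.toNNReal (ρ * pr ^ 2 * ((1 - pr) / 2) ^ (c.h.level + c.v.level))

/-- A realization: the positions of the `n` mobile nodes and the masses that the auxiliary
process gives to the crossings. -/
abbrev Config (n : ℕ) : Type := (Fin n → ℝ × ℝ) × (Crossing → ℕ)

/-- The law of the network with `n` independent mobile nodes and, independently of them,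
independent Poisson masses at the crossings, with `ρ = n`. -/
def networkLaw (p pr : ℝ) (n : ℕ) : Measure (Config n) :=
  (Measure.pi fun _ : Fin n => nodeLaw p).prod
    (Measure.infinitePi fun c : Crossing => poissonMeasure (relayIntensity pr n c))

/-- The fractal dimension of the mobile nodes, `log (4 / q) / log 2` with `q = 1 - p`. -/
def dimNodes (p : ℝ) : ℝ := Real.log (4 / (1 - p)) / Real.log 2

/-- The fractal dimension of the relays, `2 * log (2 / (1 - pr)) / log 2`. -/
def dimRelays (pr : ℝ) : ℝ := 2 * (Real.log (2 / (1 - pr)) / Real.log 2)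

/-! ### Communication model -/

/-- A potential station of the network: a mobile node or a relay at a crossing. -/
inductive Station (n : ℕ) where
  | mobile (i : Fin n)
  | relay (c : Crossing)

/-- The position of a station. -/
def Station.position {n : ℕ} (ω : Config n) : Station n → ℝ × ℝ
  | .mobile i => ω.1 i
  | .relay c => c.point

/-- Mobile nodes are always there; a crossing holds a relay exactly when the auxiliary process
has at least one point there. -/
def Station.Installed {n : ℕ} (ω : Config n) : Station n → Prop
  | .mobile _ => True
  | .relay c => 1 ≤ ω.2 c

/-- The number of mobile nodes on a street. -/
def population {n : ℕ} (ω : Config n) (s : Street) : ℕ :=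
  {i : Fin n | ω.1 i ∈ s.carrier}.ncard

/-- The nominal power `Pmax / m ^ δ` of the stations that transmit on a street with `m` mobile
nodes. On a street without mobile nodes (only relays can transmit there) it is `Pmax`. -/
def nominalPower (δ Pmax : ℝ) {n : ℕ} (ω : Config n) (s : Street) : ℝ :=
  Pmax / (max (population ω s : ℝ) 1) ^ δ

/-- A nearest-neighbor hop from `a` to `b` along the street `s`: both lie on `s`, and no mobile
node lies strictly between them. -/
def IsHop {n : ℕ} (ω : Config n) (s : Street) (a b : Station n) : Prop :=
  a ≠ b ∧ a.position ω ∈ s.carrier ∧ b.position ω ∈ s.carrier ∧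
    ∀ i : Fin n, ¬ Sbtw ℝ (a.position ω) (ω.1 i) (b.position ω)

/-- A routing path: a nonempty sequence of stations. Each station comes with the street on
which it is active; every station but the last transmits to its successor along that street, and
the last one is accounted with a street that it lies on. -/
structure Route {n : ℕ} (ω : Config n) where
  hops : ℕ
  station : Fin (hops + 1) → Station n
  street : Fin (hops + 1) → Street
  installed : ∀ i, (station i).Installed ω
  on_street : ∀ i, (station i).position ω ∈ (street i).carrier
  isHop : ∀ i : Fin hops, IsHop ω (street i.castSucc) (station i.castSucc) (station i.succ)

namespace Route

variable {n : ℕ} {ω : Config n}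

/-- The first station. -/
def source (T : Route ω) : Station n := T.station 0

/-- The last station. -/
def target (T : Route ω) : Station n := T.station (Fin.last T.hops)

/-- The path maximum power. -/
def maxPower (δ Pmax : ℝ) (T : Route ω) : ℝ :=
  Finset.univ.sup' Finset.univ_nonempty fun i => nominalPower δ Pmax ω (T.street i)

/-- The number of relays that the path goes through. -/
def relayCount (T : Route ω) : ℕ := {c : Crossing | ∃ i, T.station i = .relay c}.ncard

end Route

/-- The set `G'_k(n, E)` of mobile nodes that are connected to the central cross by a path of
maximum power at most `E` that goes through at most `k` relays. -/
def giantMax (δ Pmax : ℝ) {n : ℕ} (ω : Config n) (k : ℕ) (E : ℝ) : Set (Fin n) :=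
  {u | ∃ T : Route ω, T.source = .mobile u ∧ T.target.position ω ∈ centralCross ∧
    T.maxPower δ Pmax ≤ E ∧ T.relayCount ≤ k}

/-- The threshold `M_n = n ^ (-δ (1 - α)) Pmax`. -/
def powerBound (δ Pmax α : ℝ) (n : ℕ) : ℝ := (n : ℝ) ^ (-δ * (1 - α)) * Pmax

/-- Both versions of the claim for one realization and one hop bound `B`. Any two nodes of
`G'_1(n, M)` are joined by a path of maximum power at most `M` with at most `B` hops; and if they
can be joined at all by a path of maximum power strictly less than `M`, then by one with at most
`B` hops. -/
def ShortPaths (δ Pmax : ℝ) {n : ℕ} (ω : Config n) (M B : ℝ) : Prop :=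
  ∀ u ∈ giantMax δ Pmax ω 1 M, ∀ v ∈ giantMax δ Pmax ω 1 M,
    (∃ T : Route ω, T.source = .mobile u ∧ T.target = .mobile v ∧
      T.maxPower δ Pmax ≤ M ∧ (T.hops : ℝ) ≤ B) ∧
    ((∃ T : Route ω, T.source = .mobile u ∧ T.target = .mobile v ∧ T.maxPower δ Pmax < M) →
      ∃ T : Route ω, T.source = .mobile u ∧ T.target = .mobile v ∧
        T.maxPower δ Pmax < M ∧ (T.hops : ℝ) ≤ B)

end Hyperfractal

end

/-!
# Short paths in the hyperfractal network

Write `β = dimNodes p - 1 > 2`, so that a street of level `l` carries on average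
`(p / 2) * n * 2 ^ (-β * l)` mobile nodes. A station respects the power threshold `M_n` on a street
exactly when the street carries at least `n ^ (1 - α)` mobile nodes, so the threshold selects the
admissible streets.

For `0 < α < 1` take a level `L` with `2 ^ (β * L)` of order `n ^ α` (`exists_level`), so that
`n * 2 ^ (-L)` is of order `n ^ (1 - α / β)`. Outside an event of vanishing probability,

* all streets of level `L` are admissible, even strictly, and no street of level above `L + 3` is;
* streets of level `L`, and pieces of length `2 ^ (-L)` of any street, carry at most a constant
  times `n ^ (1 - α / β)` mobile nodes;
* every crossing of two streets of levels at most `L + 3` holds a relay: the least intensity there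
  is of order `n ^ (1 - α * dimRelays pr / β)`, a positive power of `n` because
  `dimRelays pr < β`, while there are only polynomially many such crossings.

The structure `Regular` records these properties. In a regular realization a node `u` on an
admissible street is within a piece of length `2 ^ (-L)` of a crossing with a perpendicular street
of level `L`, and two streets of level `L` cross or are joined by a third one. Hence any two nodes
on admissible streets are joined by walking along at most five pieces of streets, each with few
mobile nodes (`Regular.reach`, `Reach.along`). The central cross is never needed: membership in
`giantMax` only serves to put the end nodes on admissible streets.

The probability estimates are union bounds over sets of indices. The upper tails hold
simultaneously for infinitely many streets because the total mass of the streets is `1`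
(`pi_upper_tail_iUnion`); the failure probabilities are collected in
`networkLaw_not_shortPaths_le`.

For `α ≤ 0` an admissible street would have to carry all `n` nodes, which has vanishing
probability, and `giantMax` is empty (`networkLaw_not_shortPaths_le_of_nonpos`).
-/

open MeasureTheory ProbabilityTheory Filter Topology
open scoped ENNReal NNReal

namespace Hyperfractal

/-! ### Geometry of streets -/

lemma Street.image_point (s : Street) (I : Set ℝ) :
    s.point '' I = if s.vertical then {s.line.offset} ×ˢ I else I ×ˢ {s.line.offset} := by
  ext ⟨x, y⟩
  by_cases h : s.vertical <;> simp [Street.point, h] <;> grind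

lemma Street.convex_image_point (s : Street) {I : Set ℝ} (hI : Convex ℝ I) :
    Convex ℝ (s.point '' I) := by
  rw [Street.image_point]
  split_ifs
  · exact (convex_singleton _).prod hI
  · exact hI.prod (convex_singleton _)

lemma Street.measurableSet_image_point (s : Street) {I : Set ℝ} (hI : MeasurableSet I) :
    MeasurableSet (s.point '' I) := by
  rw [Street.image_point]
  split_ifs
  · exact (measurableSet_singleton _).prod hI
  · exact hI.prod (measurableSet_singleton _)

lemma Line.offset_mem_Icc (l : Line) : l.offset ∈ Set.Icc (0 : ℝ) 1 := by
  have h : ((l.index : ℕ) : ℝ) + 1 ≤ 2 ^ l.level := by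
    exact_mod_cast Nat.succ_le_of_lt l.index.isLt
  constructor
  · unfold Line.offset; positivity
  · unfold Line.offset
    rw [div_le_one (by positivity), pow_succ]
    linarith

/-- The closed dyadic interval of length `2 ^ (-L)` centred at the offset of the line `b` of
level `L`. -/
def cell (L : ℕ) (b : Fin (2 ^ L)) : Set ℝ :=
  Set.Icc ((b : ℝ) / 2 ^ L) (((b : ℝ) + 1) / 2 ^ L)

lemma cell_subset (L : ℕ) (b : Fin (2 ^ L)) : cell L b ⊆ Set.Icc 0 1 := by
  have h : ((b : ℕ) : ℝ) + 1 ≤ 2 ^ L := by exact_mod_cast Nat.succ_le_of_lt b.isLt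
  refine Set.Icc_subset_Icc (by positivity) ?_
  rwa [div_le_one (by positivity)]

lemma offset_mem_cell (L : ℕ) (b : Fin (2 ^ L)) : (⟨L, b⟩ : Line).offset ∈ cell L b := by
  have h2 : (0 : ℝ) < 2 ^ L := by positivity
  simp only [Line.offset, cell, Set.mem_Icc, pow_succ]
  constructor
  · rw [div_le_div_iff₀ h2 (by positivity)]; nlinarith
  · rw [div_le_div_iff₀ (by positivity) h2]; nlinarith

lemma exists_mem_cell (L : ℕ) {x : ℝ} (hx : x ∈ Set.Icc (0 : ℝ) 1) : ∃ b, x ∈ cell L b := by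
  have h2 : (0 : ℝ) < 2 ^ L := by positivity
  rcases hx.2.lt_or_eq with h1 | rfl
  · have h0 : 0 ≤ x * 2 ^ L := mul_nonneg hx.1 h2.le
    have hlt : ⌊x * 2 ^ L⌋₊ < 2 ^ L := by
      rw [Nat.floor_lt h0]; push_cast; nlinarith
    refine ⟨⟨⌊x * 2 ^ L⌋₊, hlt⟩, ?_, ?_⟩
    · rw [div_le_iff₀ h2]; exact Nat.floor_le h0
    · rw [le_div_iff₀ h2]; exact (Nat.lt_floor_add_one _).le
  · refine ⟨⟨2 ^ L - 1, by have := Nat.two_pow_pos L; omega⟩, ?_, ?_⟩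
    · rw [div_le_one h2]
      simp
    · rw [le_div_iff₀ h2]
      simp

/-- The crossing of two perpendicular streets. (For parallel streets the value is irrelevant.) -/
def Street.crossing (s t : Street) : Crossing :=
  if s.vertical then ⟨s.line, t.line⟩ else ⟨t.line, s.line⟩

lemma Street.crossing_point_left {s t : Street} :
    (s.crossing t).point = s.point t.line.offset := by
  by_cases h : s.vertical <;> simp [Street.crossing, Street.point, Crossing.point, h]

lemma Street.crossing_point_right {s t : Street} (h : t.vertical = !s.vertical) :
    (s.crossing t).point = t.point s.line.offset := by
  by_cases hs : s.vertical <;> simp [Street.crossing, Street.point, Crossing.point, hs, h]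

lemma Street.crossing_mem_left {s t : Street} : (s.crossing t).point ∈ s.carrier :=
  Street.crossing_point_left ▸ ⟨_, t.line.offset_mem_Icc, rfl⟩

lemma Street.crossing_mem_right {s t : Street} (h : t.vertical = !s.vertical) :
    (s.crossing t).point ∈ t.carrier :=
  Street.crossing_point_right h ▸ ⟨_, s.line.offset_mem_Icc, rfl⟩

lemma Street.crossing_comm {s t : Street} (h : t.vertical = !s.vertical) :
    t.crossing s = s.crossing t := by
  by_cases hs : s.vertical <;> simp_all [Street.crossing]

/-! ### Walking along streets -/

/-- `Reach ω G a b k`: there is a routing path with `k` hops from `a` to `b` all of whose stations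
are active on streets satisfying `G`. -/
inductive Reach {n : ℕ} (ω : Config n) (G : Street → Prop) : Station n → Station n → ℕ → Prop
  | refl {a : Station n} {s : Street} (ha : a.Installed ω) (has : a.position ω ∈ s.carrier)
      (hs : G s) : Reach ω G a a 0
  | step {a b c : Station n} {s : Street} {k : ℕ} (ha : a.Installed ω) (hs : G s)
      (hab : IsHop ω s a b) (hbc : Reach ω G b c k) : Reach ω G a c (k + 1)

namespace Reach

variable {n : ℕ} {ω : Config n} {G : Street → Prop}

lemma trans {a b c : Station n} {k m : ℕ} (h₁ : Reach ω G a b k) (h₂ : Reach ω G b c m) :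
    Reach ω G a c (k + m) := by
  induction h₁ with
  | refl => simpa using h₂
  | step ha hs hab _ ih =>
    have := step ha hs hab (ih h₂)
    rwa [add_right_comm] at this

lemma exists_route {a c : Station n} {k : ℕ} (h : Reach ω G a c k) :
    ∃ T : Route ω, T.source = a ∧ T.target = c ∧ T.hops = k ∧ ∀ i, G (T.street i) := by
  induction h with
  | @refl a s ha has hs =>
    exact ⟨⟨0, fun _ => a, fun _ => s, fun _ => ha, fun _ => has, fun i => i.elim0⟩,
      rfl, rfl, rfl, fun _ => hs⟩
  | @step a b c s k ha hs hab _ ih =>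
    obtain ⟨T, hT₀, hT₁, hk, hG⟩ := ih
    refine ⟨⟨T.hops + 1, Fin.cons a T.station, Fin.cons s T.street, ?_, ?_, ?_⟩, ?_, ?_, ?_, ?_⟩
    · exact Fin.cases ha T.installed
    · exact Fin.cases hab.2.1 T.on_street
    · refine Fin.cases ?_ T.isHop
      have : T.station 0 = b := hT₀
      simpa [this] using hab
    · rfl
    · rw [← hT₁]; rfl
    · simp [hk]
    · exact Fin.cases hs hG

/-- On one street, two stations are joined by at most one hop more than there are mobile nodes
strictly between them: each intermediate node splits the walk into two shorter ones. -/
lemma along {s : Street} (hs : G s) (m : ℕ) : ∀ a b : Station n, a.Installed ω → b.Installed ω →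
    a.position ω ∈ s.carrier → b.position ω ∈ s.carrier →
    {i | Sbtw ℝ (a.position ω) (ω.1 i) (b.position ω)}.ncard ≤ m →
    ∃ k ≤ m + 1, Reach ω G a b k := by
  induction m using Nat.strong_induction_on with
  | _ m ih =>
    intro a b ha hb has hbs hm
    by_cases hab : a = b
    · subst hab
      exact ⟨0, by omega, .refl ha has hs⟩
    by_cases hne : ∃ i, Sbtw ℝ (a.position ω) (ω.1 i) (b.position ω)
    · obtain ⟨i, hi⟩ := hne
      set A := {j | Sbtw ℝ (a.position ω) (ω.1 j) (ω.1 i)}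
      set B := {j | Sbtw ℝ (ω.1 i) (ω.1 j) (b.position ω)}
      have hdisj : Disjoint A B := by
        rw [Set.disjoint_left]
        intro j hjA hjB
        have h1 : Wbtw ℝ (ω.1 j) (ω.1 i) (b.position ω) := hi.wbtw.trans_left_right hjA.wbtw
        exact hjB.2.1 ((wbtw_swap_left_iff ℝ _).1 ⟨h1, hjB.wbtw⟩)
      have hiAB : i ∉ A ∪ B := by
        rintro (h | h)
        · exact h.2.2 rfl
        · exact h.2.1 rfl
      have hsub : insert i (A ∪ B) ⊆ {j | Sbtw ℝ (a.position ω) (ω.1 j) (b.position ω)} := by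
        rintro j (rfl | hj | hj)
        · exact hi
        · exact hi.trans_left hj
        · exact hi.trans_right hj
      have hcard := (Set.ncard_le_ncard hsub (Set.toFinite _)).trans hm
      rw [Set.ncard_insert_of_notMem hiAB (Set.toFinite _), Set.ncard_union_eq hdisj] at hcard
      have his : ω.1 i ∈ s.carrier :=
        (s.convex_image_point (convex_Icc _ _)).mem_of_wbtw hi.wbtw has hbs
      obtain ⟨k₁, hk₁, h₁⟩ := ih A.ncard (by omega) a (.mobile i) ha trivial has his le_rfl
      obtain ⟨k₂, hk₂, h₂⟩ := ih B.ncard (by omega) (.mobile i) b trivial hb his hbs le_rfl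
      exact ⟨_, by omega, h₁.trans h₂⟩
    · push Not at hne
      exact ⟨1, by omega, .step ha hs ⟨hab, has, hbs, hne⟩ (.refl hb hbs hs)⟩

/-- Walking inside a convex part of a street, the number of hops is controlled by the number of
mobile nodes there. -/
lemma along_image {s : Street} (hs : G s) {I : Set ℝ} (hI : Convex ℝ I) (hI1 : I ⊆ Set.Icc 0 1)
    {N : ℕ} {a b : Station n} (ha : a.Installed ω) (hb : b.Installed ω)
    (haI : a.position ω ∈ s.point '' I) (hbI : b.position ω ∈ s.point '' I)
    (hN : {i | ω.1 i ∈ s.point '' I}.ncard ≤ N) : ∃ k ≤ N + 1, Reach ω G a b k := by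
  refine along hs N a b ha hb (Set.image_mono hI1 haI) (Set.image_mono hI1 hbI) ?_
  refine (Set.ncard_le_ncard (fun i hi => ?_) (Set.toFinite _)).trans hN
  exact (s.convex_image_point hI).mem_of_wbtw hi.wbtw haI hbI

end Reach

/-! ### Regular realizations -/

/-- The properties of a realization that make all well-populated streets mutually accessible within
few hops: streets of level `L` are admissible, they and all cells of level `L` on any street carry
at most `N` mobile nodes, and all crossings of streets of levels at most `L + 3` hold a relay. -/
structure Regular {n : ℕ} (ω : Config n) (G : Street → Prop) (L N : ℕ) : Prop where
  good : ∀ s : Street, s.line.level = L → G s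
  level_le : ∀ s : Street, G s → s.line.level ≤ L + 3
  population_le : ∀ s : Street, s.line.level = L → population ω s ≤ N
  cell_le : ∀ (s : Street) (b : Fin (2 ^ L)), {i | ω.1 i ∈ s.point '' cell L b}.ncard ≤ N
  relay : ∀ c : Crossing, c.v.level ≤ L + 3 → c.h.level ≤ L + 3 → 1 ≤ ω.2 c

namespace Regular

variable {n : ℕ} {ω : Config n} {G : Street → Prop} {L N : ℕ}

lemma crossing_installed (h : Regular ω G L N) {s t : Street} (hs : G s) (ht : G t) :
    (Station.relay (s.crossing t) : Station n).Installed ω := by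
  unfold Street.crossing
  split_ifs
  · exact h.relay _ (h.level_le s hs) (h.level_le t ht)
  · exact h.relay _ (h.level_le t ht) (h.level_le s hs)

/-- Inside the cell of a node of an admissible street there is a crossing with a street of
level `L`, reached within `N + 1` hops in either direction. -/
lemma exists_access (h : Regular ω G L N) {s : Street} (hs : G s) {u : Fin n}
    (hu : ω.1 u ∈ s.carrier) :
    ∃ t : Street, t.line.level = L ∧ t.vertical = (!s.vertical) ∧
      (∃ k ≤ N + 1, Reach ω G (.mobile u) (.relay (s.crossing t)) k) ∧
      (∃ k ≤ N + 1, Reach ω G (.relay (s.crossing t)) (.mobile u) k) := by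
  obtain ⟨x, hx, hxu⟩ := hu
  obtain ⟨b, hb⟩ := exists_mem_cell L hx
  let t : Street := ⟨!s.vertical, ⟨L, b⟩⟩
  have hr := h.crossing_installed hs (h.good t rfl)
  have hru : (s.crossing t).point ∈ s.point '' cell L b :=
    Street.crossing_point_left ▸ ⟨_, offset_mem_cell L b, rfl⟩
  have huu : ω.1 u ∈ s.point '' cell L b := ⟨x, hb, hxu⟩
  have hc : Convex ℝ (cell L b) := convex_Icc _ _
  exact ⟨t, rfl, rfl,
    Reach.along_image hs hc (cell_subset L b) trivial hr huu hru (h.cell_le s b),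
    Reach.along_image hs hc (cell_subset L b) hr trivial hru huu (h.cell_le s b)⟩

/-- Moving between two crossings of a street of level `L`. -/
lemma reach_crossings (h : Regular ω G L N) {t r s : Street} (ht : t.line.level = L)
    (hr : G r) (hs : G s) (hrt : t.vertical = !r.vertical) :
    ∃ k ≤ N + 1, Reach ω G (.relay (r.crossing t)) (.relay (t.crossing s)) k :=
  Reach.along_image (h.good t ht) (convex_Icc _ _) subset_rfl
    (h.crossing_installed hr (h.good t ht)) (h.crossing_installed (h.good t ht) hs)
    (Street.crossing_mem_right hrt) Street.crossing_mem_left (h.population_le t ht)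

/-- Leave each street through a crossing in the cell of the node, and connect the two streets of
level `L` reached in this way directly or, if they are parallel, by a third one. -/
theorem reach (h : Regular ω G L N) {s s' : Street} (hs : G s) (hs' : G s') {u v : Fin n}
    (hu : ω.1 u ∈ s.carrier) (hv : ω.1 v ∈ s'.carrier) :
    ∃ k ≤ 5 * (N + 1), Reach ω G (.mobile u) (.mobile v) k := by
  obtain ⟨t, htL, hts, ⟨k₁, hk₁, h₁⟩, -⟩ := h.exists_access hs hu
  obtain ⟨t', htL', hts', -, ⟨k₂, hk₂, h₂⟩⟩ := h.exists_access hs' hv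
  have ht := h.good t htL
  have ht' := h.good t' htL'
  rw [← Street.crossing_comm hts'] at h₂
  by_cases hv' : t'.vertical = !t.vertical
  · obtain ⟨k₃, hk₃, h₃⟩ := h.reach_crossings htL hs ht' hts
    obtain ⟨k₄, hk₄, h₄⟩ := h.reach_crossings htL' ht hs' hv'
    exact ⟨_, by omega, ((h₁.trans h₃).trans h₄).trans h₂⟩
  · let w : Street := ⟨!t.vertical, ⟨L, ⟨0, Nat.two_pow_pos L⟩⟩⟩
    have hw := h.good w rfl
    have htw : t'.vertical = !w.vertical := by simp [w]; simpa using hv'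
    obtain ⟨k₃, hk₃, h₃⟩ := h.reach_crossings htL hs hw hts
    obtain ⟨k₄, hk₄, h₄⟩ := h.reach_crossings (t := w) rfl ht ht' rfl
    obtain ⟨k₅, hk₅, h₅⟩ := h.reach_crossings htL' hw hs' htw
    exact ⟨_, by omega, (((h₁.trans h₃).trans h₄).trans h₅).trans h₂⟩

end Regular

/-! ### From regular realizations to short paths -/

lemma Route.street_le_maxPower {n : ℕ} {ω : Config n} (δ Pmax : ℝ) (T : Route ω)
    (i : Fin (T.hops + 1)) : nominalPower δ Pmax ω (T.street i) ≤ T.maxPower δ Pmax :=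
  Finset.le_sup' (fun i => nominalPower δ Pmax ω (T.street i)) (Finset.mem_univ i)

lemma exists_street_of_mem_giantMax {n : ℕ} {ω : Config n} {δ Pmax E : ℝ} {k : ℕ} {u : Fin n}
    (hu : u ∈ giantMax δ Pmax ω k E) :
    ∃ s : Street, ω.1 u ∈ s.carrier ∧ nominalPower δ Pmax ω s ≤ E := by
  obtain ⟨T, hT, -, hE, -⟩ := hu
  refine ⟨T.street 0, ?_, (T.street_le_maxPower δ Pmax 0).trans hE⟩
  have h := T.on_street 0
  rw [show T.station 0 = .mobile u from hT] at h
  exact h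

/-- Regularity is required for both versions of the power constraint. Membership in `giantMax` is
used only to place the end nodes on admissible streets; in the strict version the given path does
this. -/
theorem shortPaths_of_regular {n : ℕ} {ω : Config n} {δ Pmax M B : ℝ} {L N : ℕ}
    (h₁ : Regular ω (fun s => nominalPower δ Pmax ω s ≤ M) L N)
    (h₂ : Regular ω (fun s => nominalPower δ Pmax ω s < M) L N)
    (hB : ((5 * (N + 1) : ℕ) : ℝ) ≤ B) : ShortPaths δ Pmax ω M B := by
  intro u hu v hv
  obtain ⟨s, hus, hs⟩ := exists_street_of_mem_giantMax hu
  obtain ⟨s', hvs, hs'⟩ := exists_street_of_mem_giantMax hv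
  constructor
  · obtain ⟨k, hk, h⟩ := h₁.reach hs hs' hus hvs
    obtain ⟨T, h0, h1, hT, hG⟩ := h.exists_route
    refine ⟨T, h0, h1, Finset.sup'_le _ _ fun i _ => hG i, le_trans ?_ hB⟩
    exact_mod_cast hT.trans_le hk
  · rintro ⟨T', h0', h1', hM⟩
    have hu' := T'.on_street 0
    rw [show T'.station 0 = .mobile u from h0'] at hu'
    have hv' := T'.on_street (Fin.last _)
    rw [show T'.station (Fin.last _) = .mobile v from h1'] at hv'
    obtain ⟨k, hk, h⟩ := h₂.reach ((T'.street_le_maxPower δ Pmax _).trans_lt hM)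
      ((T'.street_le_maxPower δ Pmax _).trans_lt hM) hu' hv'
    obtain ⟨T, h0, h1, hT, hG⟩ := h.exists_route
    refine ⟨T, h0, h1, (Finset.sup'_lt_iff _).2 fun i _ => hG i, le_trans ?_ hB⟩
    exact_mod_cast hT.trans_le hk

lemma powerBound_eq (δ Pmax α : ℝ) (n : ℕ) :
    powerBound δ Pmax α n = Pmax / ((n : ℝ) ^ (1 - α)) ^ δ := by
  rw [powerBound, show -δ * (1 - α) = (1 - α) * (-δ) by ring, Real.rpow_mul n.cast_nonneg,
    Real.rpow_neg (by positivity), div_eq_mul_inv, mul_comm]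

/-- The power threshold is a population threshold, provided the latter exceeds `1`. -/
lemma nominalPower_le_iff {n : ℕ} {ω : Config n} {δ Pmax α : ℝ} (hδ : 0 < δ) (hP : 0 < Pmax)
    (hn : 1 < (n : ℝ) ^ (1 - α)) (s : Street) :
    nominalPower δ Pmax ω s ≤ powerBound δ Pmax α n ↔ (n : ℝ) ^ (1 - α) ≤ population ω s := by
  have hm : (0 : ℝ) < max (population ω s : ℝ) 1 := lt_max_of_lt_right one_pos
  rw [powerBound_eq, nominalPower, div_le_div_iff_of_pos_left hP (by positivity) (by positivity),
    Real.rpow_le_rpow_iff (by positivity) hm.le hδ, le_max_iff, or_iff_left hn.not_ge]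

lemma nominalPower_lt_iff {n : ℕ} {ω : Config n} {δ Pmax α : ℝ} (hδ : 0 < δ) (hP : 0 < Pmax)
    (hn : 1 < (n : ℝ) ^ (1 - α)) (s : Street) :
    nominalPower δ Pmax ω s < powerBound δ Pmax α n ↔ (n : ℝ) ^ (1 - α) < population ω s := by
  have hm : (0 : ℝ) < max (population ω s : ℝ) 1 := lt_max_of_lt_right one_pos
  rw [powerBound_eq, nominalPower, div_lt_div_iff_of_pos_left hP (by positivity) (by positivity),
    Real.rpow_lt_rpow_iff (by positivity) hm.le hδ, lt_max_iff, or_iff_left hn.not_gt]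

/-! ### The law of one mobile node -/

/-- Lines as pairs (level, index). -/
def Line.equivSigma : Line ≃ Σ l : ℕ, Fin (2 ^ l) where
  toFun l := ⟨l.level, l.index⟩
  invFun x := ⟨x.1, x.2⟩

/-- Streets as pairs (direction, line). -/
def Street.equivProd : Street ≃ Bool × Line where
  toFun s := (s.vertical, s.line)
  invFun x := ⟨x.1, x.2⟩

instance : Countable Line := Line.equivSigma.countable_iff.2 inferInstance

instance : Countable Street := Street.equivProd.countable_iff.2 inferInstance

/-- The level of a dyadic coordinate is read off the power of two in its denominator. -/
lemma Line.offset_injective : Function.Injective Line.offset := by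
  rintro ⟨a, i⟩ ⟨b, j⟩ h
  have key : (2 * (i : ℕ) + 1) * 2 ^ b = (2 * (j : ℕ) + 1) * 2 ^ a := by
    simp only [Line.offset, pow_succ] at h
    rw [div_eq_div_iff (by positivity) (by positivity)] at h
    have : ((2 * (i : ℕ) + 1 : ℝ)) * 2 ^ b = (2 * (j : ℕ) + 1) * 2 ^ a := by linarith
    exact_mod_cast this
  have hab : a = b := by
    have h2 := congrArg (fun x => x.factorization 2) key
    have hodd : ∀ k : ℕ, (2 * k + 1).factorization 2 = 0 := fun k =>
      Nat.factorization_eq_zero_of_not_dvd (by omega)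
    simpa [Nat.factorization_mul, Nat.prime_two.factorization_pow, hodd] using h2.symm
  subst hab
  have : (i : ℕ) = j := by
    have := Nat.eq_of_mul_eq_mul_right (Nat.two_pow_pos a) key
    omega
  rw [Fin.ext this]

lemma Street.measurable_point (s : Street) : Measurable s.point := by
  unfold Street.point
  split_ifs <;> fun_prop

lemma Street.point_injective (s : Street) : Function.Injective s.point := by
  intro x y h
  by_cases hs : s.vertical <;> simpa [Street.point, hs] using h

/-- Distinct streets meet in at most one point. -/
lemma Street.subsingleton_preimage {s t : Street} (hst : s ≠ t) (I : Set ℝ) :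
    (t.point ⁻¹' (s.point '' I)).Subsingleton := by
  rintro x ⟨x', -, hx⟩ y ⟨y', -, hy⟩
  obtain ⟨v, l⟩ := s
  obtain ⟨w, m⟩ := t
  have hl : v = w → l.offset ≠ m.offset := fun h h' =>
    hst (by rw [h, Line.offset_injective h'])
  cases v <;> cases w <;> simp_all [Street.point]

/-- The density of the mobile nodes on a street of level `l`. -/
noncomputable def density (p : ℝ) (l : ℕ) : ℝ := (p / 2) * ((1 - p) / 2) ^ l

lemma density_pos {p : ℝ} (hp0 : 0 < p) (hp1 : p < 1) (l : ℕ) : 0 < density p l := by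
  have : 0 < 1 - p := by linarith
  unfold density; positivity

lemma density_anti {p : ℝ} (hp0 : 0 < p) (hp1 : p < 1) {l m : ℕ} (h : l ≤ m) :
    density p m ≤ density p l :=
  mul_le_mul_of_nonneg_left
    (pow_le_pow_of_le_one (by linarith) (by linarith) h) (by positivity)

lemma nodeLaw_image (p : ℝ) (s : Street) {I : Set ℝ} (hI : MeasurableSet I)
    (hI1 : I ⊆ Set.Icc 0 1) :
    nodeLaw p (s.point '' I) = ENNReal.ofReal (density p s.line.level) * volume I := by
  have hm := s.measurableSet_image_point hI
  rw [nodeLaw, Measure.sum_apply _ hm, tsum_eq_single s]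
  · rw [Measure.smul_apply, Measure.map_apply s.measurable_point hm,
      Set.preimage_image_eq _ s.point_injective, Measure.restrict_apply hI,
      Set.inter_eq_left.2 hI1, smul_eq_mul, density]
  · intro t hts
    rw [Measure.smul_apply, Measure.map_apply t.measurable_point hm,
      (Street.subsingleton_preimage hts.symm I).measure_zero, smul_zero]

lemma nodeLaw_carrier (p : ℝ) (s : Street) :
    nodeLaw p s.carrier = ENNReal.ofReal (density p s.line.level) := by
  rw [Street.carrier, nodeLaw_image p s measurableSet_Icc subset_rfl]
  simp

lemma nodeLaw_cell (p : ℝ) (s : Street) (L : ℕ) (b : Fin (2 ^ L)) :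
    nodeLaw p (s.point '' cell L b) =
      ENNReal.ofReal (density p s.line.level) * (2 ^ L)⁻¹ := by
  rw [nodeLaw_image p s (I := cell L b) measurableSet_Icc (cell_subset L b), cell,
    Real.volume_Icc, ← sub_div,
    add_sub_cancel_left, one_div, ENNReal.ofReal_inv_of_pos (by positivity),
    ENNReal.ofReal_pow zero_le_two, ENNReal.ofReal_ofNat]

lemma tsum_density {p : ℝ} (hp0 : 0 < p) (hp1 : p < 1) :
    ∑' s : Street, ENNReal.ofReal (density p s.line.level) = 1 := by
  have hq : 0 ≤ 1 - p := by linarith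
  have h1 : ∑' l : Line, ENNReal.ofReal (density p l.level) = ENNReal.ofReal (1 / 2) := by
    rw [← Line.equivSigma.symm.tsum_eq, ENNReal.tsum_sigma']
    have h : ∀ l : ℕ, ∑' b : Fin (2 ^ l),
        ENNReal.ofReal (density p (Line.equivSigma.symm ⟨l, b⟩).level) =
          ENNReal.ofReal ((p / 2) * (1 - p) ^ l) := by
      intro l
      rw [tsum_fintype]
      simp only [Line.equivSigma, Equiv.coe_fn_symm_mk, Finset.sum_const, Finset.card_univ,
        Fintype.card_fin, nsmul_eq_mul]
      rw [← ENNReal.ofReal_natCast, ← ENNReal.ofReal_mul (by positivity)]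
      congr 1
      rw [density, div_pow]
      push_cast
      field_simp
    simp_rw [h]
    rw [← ENNReal.ofReal_tsum_of_nonneg (fun l => by positivity)
      ((summable_geometric_of_lt_one hq (by linarith)).mul_left _), tsum_mul_left,
      tsum_geometric_of_lt_one hq (by linarith)]
    congr 1
    rw [sub_sub_cancel]
    field_simp
  rw [← Street.equivProd.symm.tsum_eq, ENNReal.tsum_prod']
  simp only [Street.equivProd, Equiv.coe_fn_symm_mk,
    tsum_fintype (L := .unconditional Bool), Fintype.sum_bool, h1]
  rw [← ENNReal.ofReal_add (by norm_num) (by norm_num)]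
  norm_num

lemma isProbabilityMeasure_nodeLaw {p : ℝ} (hp0 : 0 < p) (hp1 : p < 1) :
    IsProbabilityMeasure (nodeLaw p) := by
  constructor
  rw [nodeLaw, Measure.sum_apply _ .univ, ← tsum_density hp0 hp1]
  refine tsum_congr fun s => ?_
  rw [Measure.smul_apply, Measure.map_apply s.measurable_point .univ]
  simp [density]

/-! ### Tail bounds for occupation numbers -/

section Tails

variable {X : Type*} [MeasurableSpace X] (μ : Measure X) [IsProbabilityMeasure μ]

/-- Union bound over the `k`-element sets of indices that could lie in `S`; no measurability of `S`
is needed. -/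
lemma pi_upper_tail (S : Set X) (n k : ℕ) :
    Measure.pi (fun _ : Fin n => μ) {ω | k ≤ {i | ω i ∈ S}.ncard} ≤
      (n.choose k : ℝ≥0∞) * μ S ^ k := by
  classical
  have hsub : {ω : Fin n → X | k ≤ {i | ω i ∈ S}.ncard} ⊆
      ⋃ A ∈ Finset.powersetCard k (Finset.univ : Finset (Fin n)),
        Set.univ.pi fun i => if i ∈ A then S else Set.univ := by
    intro ω hω
    rw [Set.mem_ofPred_eq, Set.ncard_eq_toFinset_card'] at hω
    obtain ⟨A, hA, hk⟩ := Finset.exists_subset_card_eq hω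
    simp only [Set.mem_iUnion, Finset.mem_powersetCard]
    refine ⟨A, ⟨Finset.subset_univ _, hk⟩, fun i _ => ?_⟩
    by_cases hi : i ∈ A
    · simpa [hi] using hA hi
    · simp [hi]
  refine (measure_mono hsub).trans ((measure_biUnion_finset_le _ _).trans ?_)
  have h : ∀ A ∈ Finset.powersetCard k (Finset.univ : Finset (Fin n)),
      Measure.pi (fun _ : Fin n => μ) (Set.univ.pi fun i => if i ∈ A then S else Set.univ) =
        μ S ^ k := by
    intro A hA
    rw [Measure.pi_pi]
    simp_rw [apply_ite μ, measure_univ]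
    rw [Finset.prod_ite_mem, Finset.univ_inter, Finset.prod_const, (Finset.mem_powersetCard.1 hA).2]
  rw [Finset.sum_congr rfl h, Finset.sum_const, Finset.card_powersetCard, Finset.card_fin,
    nsmul_eq_mul]

/-- For a countable family of sets of total mass at most `1`, the union bound costs only a factor
`n`: one of the `k` factors of `μ (S j) ^ k` is used to sum over the family. -/
lemma pi_upper_tail_iUnion {J : Type*} [Countable J] (S : J → Set X) (Q : J → Prop) {y : ℝ≥0∞}
    (hy : ∀ j, Q j → μ (S j) ≤ y) (hS : ∑' j, μ (S j) ≤ 1) (n m : ℕ) :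
    Measure.pi (fun _ : Fin n => μ) {ω | ∃ j, Q j ∧ m + 1 ≤ {i | ω i ∈ S j}.ncard} ≤
      (n.choose (m + 1) : ℝ≥0∞) * y ^ m := by
  have hterm : ∀ j, Measure.pi (fun _ : Fin n => μ) {ω | Q j ∧ m + 1 ≤ {i | ω i ∈ S j}.ncard} ≤
      (n.choose (m + 1) : ℝ≥0∞) * y ^ m * μ (S j) := by
    intro j
    by_cases hQ : Q j
    · simp only [hQ, true_and]
      refine (pi_upper_tail μ (S j) n (m + 1)).trans ?_
      rw [pow_succ, ← mul_assoc]
      gcongr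
      exact hy j hQ
    · simp [hQ]
  rw [Set.ofPred_exists]
  refine (measure_iUnion_le _).trans ((ENNReal.tsum_le_tsum hterm).trans ?_)
  rw [ENNReal.tsum_mul_left]
  exact mul_le_of_le_one_right' hS

/-- A level that is four times the largest mean is exceeded with exponentially small
probability. -/
lemma pi_upper_tail_iUnion_exp {J : Type*} [Countable J] (S : J → Set X) (Q : J → Prop) {y : ℝ}
    (hy0 : 0 ≤ y) (hy : ∀ j, Q j → μ (S j) ≤ ENNReal.ofReal y) (hS : ∑' j, μ (S j) ≤ 1) {n k : ℕ}
    (hk : 1 ≤ k) (hyk : 4 * (n * y) ≤ k) :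
    Measure.pi (fun _ : Fin n => μ) {ω | ∃ j, Q j ∧ k ≤ {i | ω i ∈ S j}.ncard} ≤
      ENNReal.ofReal (2 * n * Real.exp (-(k / 10))) := by
  obtain ⟨m, rfl⟩ := Nat.exists_eq_add_of_le' hk
  refine (pi_upper_tail_iUnion μ S Q hy hS n m).trans ?_
  rw [← ENNReal.ofReal_pow hy0, ← ENNReal.ofReal_natCast, ← ENNReal.ofReal_mul (by positivity)]
  refine ENNReal.ofReal_le_ofReal ?_
  have h1 : ((n.choose (m + 1) : ℕ) : ℝ) ≤ n ^ (m + 1) / (m.factorial : ℝ) := by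
    refine (Nat.choose_le_pow_div (m + 1) n).trans ?_
    gcongr
    omega
  have h2 : (2 * (n * y)) ^ m / (m.factorial : ℝ) ≤ Real.exp (2 * (n * y)) :=
    Real.pow_div_factorial_le_exp _ (by positivity) m
  have h3 : Real.exp (2 * (n * y)) ≤ Real.exp ((m + 1 : ℕ) / 2) := Real.exp_le_exp.2 (by linarith)
  have h4 : Real.exp ((m + 1 : ℕ) / 2) ≤ 2 ^ (m + 1) * Real.exp (-((m + 1 : ℕ) / 10)) := by
    have : (2 : ℝ) ^ (m + 1) = Real.exp (Real.log 2 * (m + 1 : ℕ)) := by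
      rw [← Real.rpow_natCast, Real.rpow_def_of_pos two_pos]
    rw [this, ← Real.exp_add]
    have hl := Real.log_two_gt_d9
    have hm : (0 : ℝ) ≤ (m + 1 : ℕ) := Nat.cast_nonneg _
    exact Real.exp_le_exp.2 (by nlinarith)
  calc ((n.choose (m + 1) : ℕ) : ℝ) * y ^ m ≤ n ^ (m + 1) / (m.factorial : ℝ) * y ^ m := by gcongr
    _ = n / 2 ^ m * ((2 * (n * y)) ^ m / (m.factorial : ℝ)) := by
        rw [mul_pow, mul_pow, pow_succ]; field_simp
    _ ≤ n / 2 ^ m * (2 ^ (m + 1) * Real.exp (-((m + 1 : ℕ) / 10))) := by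
        gcongr
        exact h2.trans (h3.trans h4)
    _ = 2 * n * Real.exp (-((m + 1 : ℕ) / 10)) := by
        rw [pow_succ]; field_simp

/-- Chernoff bound with the exponential weight `2 ^ (k - N)`, where `N` is the occupation number
of `S`. -/
lemma pi_lower_tail {S : Set X} (hS : MeasurableSet S) {y : ℝ} (hy0 : 0 ≤ y)
    (hy : μ S = ENNReal.ofReal y) (n k : ℕ) :
    Measure.pi (fun _ : Fin n => μ) {ω | {i | ω i ∈ S}.ncard ≤ k} ≤
      ENNReal.ofReal (2 ^ k * Real.exp (-(n * y / 2))) := by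
  classical
  have hy1 : y ≤ 1 := by
    have := prob_le_one (μ := μ) (s := S)
    rwa [hy, ENNReal.ofReal_le_one] at this
  have hyc : μ Sᶜ = ENNReal.ofReal (1 - y) := by
    rw [prob_compl_eq_one_sub hS, hy, ENNReal.ofReal_sub _ hy0, ENNReal.ofReal_one]
  have hsub : {ω : Fin n → X | {i | ω i ∈ S}.ncard ≤ k} ⊆
      ⋃ A ∈ (Finset.univ : Finset (Finset (Fin n))).filter (·.card ≤ k),
        Set.univ.pi fun i => if i ∈ A then S else Sᶜ := by
    intro ω hω
    rw [Set.mem_ofPred_eq, Set.ncard_eq_toFinset_card'] at hω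
    simp only [Set.mem_iUnion]
    refine ⟨_, Finset.mem_filter.2 ⟨Finset.mem_univ _, hω⟩, fun i _ => ?_⟩
    by_cases hi : ω i ∈ S <;> simp [hi]
  refine (measure_mono hsub).trans ((measure_biUnion_finset_le _ _).trans ?_)
  have h : ∀ A : Finset (Fin n),
      Measure.pi (fun _ : Fin n => μ) (Set.univ.pi fun i => if i ∈ A then S else Sᶜ) =
        ENNReal.ofReal (y ^ A.card * (1 - y) ^ (n - A.card)) := by
    intro A
    rw [Measure.pi_pi]
    simp_rw [apply_ite μ, hy, hyc]
    rw [Finset.prod_ite, Finset.prod_const, Finset.prod_const, Finset.filter_mem_eq_inter,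
      Finset.univ_inter, Finset.filter_not, Finset.filter_mem_eq_inter, Finset.univ_inter,
      ← Finset.compl_eq_univ_sdiff, Finset.card_compl, Fintype.card_fin,
      ENNReal.ofReal_mul (by positivity), ENNReal.ofReal_pow hy0,
      ENNReal.ofReal_pow (by linarith)]
  have h1y : 0 ≤ 1 - y := by linarith
  simp_rw [h]
  rw [← ENNReal.ofReal_sum_of_nonneg fun A _ => by positivity]
  refine ENNReal.ofReal_le_ofReal ?_
  calc ∑ A ∈ (Finset.univ : Finset (Finset (Fin n))).filter (·.card ≤ k),
        y ^ A.card * (1 - y) ^ (n - A.card)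
      ≤ ∑ A ∈ (Finset.univ : Finset (Finset (Fin n))).filter (·.card ≤ k),
        2 ^ k * ((y / 2) ^ A.card * (1 - y) ^ (n - A.card)) := by
        -- on the event, the weight `2 ^ (k - A.card)` is at least `1`
        refine Finset.sum_le_sum fun A hA => ?_
        have hA' : A.card ≤ k := (Finset.mem_filter.1 hA).2
        have h2 : y ^ A.card ≤ 2 ^ k * (y / 2) ^ A.card := by
          rw [div_pow, mul_div_assoc', le_div_iff₀ (by positivity), mul_comm]
          gcongr
          norm_num
        rw [← mul_assoc]
        gcongr
    _ ≤ ∑ A : Finset (Fin n), 2 ^ k * ((y / 2) ^ A.card * (1 - y) ^ (n - A.card)) :=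
        Finset.sum_le_sum_of_subset_of_nonneg (Finset.filter_subset _ _)
          fun A _ _ => by positivity
    _ = 2 ^ k * (1 - y / 2) ^ n := by
        rw [← Finset.mul_sum, Fin.sum_pow_mul_eq_add_pow]
        congr 2
        ring
    _ ≤ 2 ^ k * Real.exp (-(y / 2)) ^ n := by
        gcongr
        · linarith
        · linarith [Real.add_one_le_exp (-(y / 2))]
    _ = 2 ^ k * Real.exp (-(n * y / 2)) := by
        rw [← Real.exp_nat_mul]
        congr 2
        ring

end Tails

/-! ### Relays -/

lemma infinitePi_no_relay {ι : Type*} (r : ι → ℝ≥0) (c : ι) :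
    Measure.infinitePi (fun c => poissonMeasure (r c)) {ω | ω c = 0} =
      ENNReal.ofReal (Real.exp (-(r c))) := by
  have h := Measure.infinitePi_map_eval (fun c => poissonMeasure (r c)) c
  have h1 : {ω : ι → ℕ | ω c = 0} = (fun ω => ω c) ⁻¹' {0} := rfl
  rw [h1, ← Measure.map_apply (measurable_pi_apply c) (measurableSet_singleton 0)]
  have h' : Measure.map (fun ω : ι → ℕ => ω c) (Measure.infinitePi fun c => poissonMeasure (r c)) =
    poissonMeasure (r c) := h
  rw [h', poissonMeasure_singleton]
  simp

/-- The lines of level less than `m`. -/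
def linesBelow (m : ℕ) : Finset Line :=
  ((Finset.range m).sigma fun _ => Finset.univ).map Line.equivSigma.symm.toEmbedding

lemma mem_linesBelow {m : ℕ} {l : Line} : l ∈ linesBelow m ↔ l.level < m := by
  simp only [linesBelow, Finset.mem_map_equiv, Equiv.symm_symm, Finset.mem_sigma, Finset.mem_range,
    Finset.mem_univ, and_true]
  rfl

lemma card_linesBelow_le (m : ℕ) : (linesBelow m).card ≤ 2 ^ m := by
  rw [linesBelow, Finset.card_map, Finset.card_sigma]
  simp only [Finset.card_univ, Fintype.card_fin]
  rw [Nat.geomSum_eq le_rfl]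
  simp

lemma relays_missing_le {pr : ℝ} (hpr0 : 0 < pr) (hpr1 : pr < 1) (n m : ℕ) :
    Measure.infinitePi (fun c : Crossing => poissonMeasure (relayIntensity pr n c))
      {ω | ∃ c : Crossing, c.v.level ≤ m ∧ c.h.level ≤ m ∧ ω c = 0} ≤
    ENNReal.ofReal (2 ^ (m + 1) * 2 ^ (m + 1) *
      Real.exp (-(n * pr ^ 2 * ((1 - pr) / 2) ^ (m + m)))) := by
  have hsub : {ω : Crossing → ℕ | ∃ c : Crossing, c.v.level ≤ m ∧ c.h.level ≤ m ∧ ω c = 0} ⊆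
      ⋃ x ∈ linesBelow (m + 1) ×ˢ linesBelow (m + 1), {ω | ω ⟨x.1, x.2⟩ = 0} := by
    rintro ω ⟨⟨v, h⟩, hv, hh, h0⟩
    simp only [Set.mem_iUnion, Finset.mem_product, mem_linesBelow]
    exact ⟨(v, h), ⟨Nat.lt_succ_of_le hv, Nat.lt_succ_of_le hh⟩, h0⟩
  refine (measure_mono hsub).trans ((measure_biUnion_finset_le _ _).trans ?_)
  have hb : ∀ x ∈ linesBelow (m + 1) ×ˢ linesBelow (m + 1),
      Measure.infinitePi (fun c : Crossing => poissonMeasure (relayIntensity pr n c))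
        {ω | ω ⟨x.1, x.2⟩ = 0} ≤
      ENNReal.ofReal (Real.exp (-(n * pr ^ 2 * ((1 - pr) / 2) ^ (m + m)))) := by
    rintro ⟨v, h⟩ hx
    simp only [Finset.mem_product, mem_linesBelow] at hx
    rw [infinitePi_no_relay]
    refine ENNReal.ofReal_le_ofReal (Real.exp_le_exp.2 (neg_le_neg ?_))
    have hr : 0 ≤ (1 - pr) / 2 := by linarith
    refine le_trans ?_ (Real.le_coe_toNNReal _)
    refine mul_le_mul_of_nonneg_left ?_ (by positivity)
    exact pow_le_pow_of_le_one hr (by linarith) (by simp only; omega)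
  refine (Finset.sum_le_card_nsmul _ _ _ hb).trans ?_
  rw [nsmul_eq_mul, ← ENNReal.ofReal_natCast, ← ENNReal.ofReal_mul (by positivity),
    Finset.card_product]
  refine ENNReal.ofReal_le_ofReal ?_
  have := card_linesBelow_le (m + 1)
  gcongr
  push_cast
  gcongr <;> exact_mod_cast this

/-! ### Probability of an irregular realization -/

lemma sum_cell_le {p : ℝ} (hp0 : 0 < p) (hp1 : p < 1) (L : ℕ) :
    ∑' x : Street × Fin (2 ^ L), nodeLaw p (x.1.point '' cell L x.2) ≤ 1 := by
  rw [ENNReal.tsum_prod', ← tsum_density hp0 hp1]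
  refine ENNReal.tsum_le_tsum fun s => ?_
  simp_rw [nodeLaw_cell, tsum_fintype]
  rw [Finset.sum_const, Finset.card_univ, Fintype.card_fin, nsmul_eq_mul, mul_left_comm]
  push_cast
  rw [ENNReal.mul_inv_cancel (by positivity) (by simp), mul_one]

/-- A union bound over the ways in which a realization can fail to be regular: crowded streets of
level above `L + 3`, crowded streets of level `L`, crowded cells, sparse streets of level `L`, and
missing relays. -/
theorem networkLaw_not_shortPaths_le {p pr δ Pmax α B : ℝ} (hp0 : 0 < p) (hp1 : p < 1)
    (hpr0 : 0 < pr) (hpr1 : pr < 1) (hδ : 0 < δ) (hPmax : 0 < Pmax) {n L N : ℕ}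
    (hn : 1 < (n : ℝ) ^ (1 - α)) (h_high : 4 * (n * density p (L + 4)) ≤ (n : ℝ) ^ (1 - α))
    (h_pop : 4 * (n * density p L) ≤ N) (h_cell : 4 * (n * (1 / 2 ^ L)) ≤ (N : ℝ))
    (hB : 5 * ((N : ℝ) + 1) ≤ B) :
    networkLaw p pr n {ω | ¬ ShortPaths δ Pmax ω (powerBound δ Pmax α n) B} ≤
      ENNReal.ofReal (2 * n * Real.exp (-((n : ℝ) ^ (1 - α) / 10)) +
        2 * (2 * n * Real.exp (-(N / 10))) +
        2 * 2 ^ L * Real.exp ((n : ℝ) ^ (1 - α) - n * density p L / 2) +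
        2 ^ (L + 4) * 2 ^ (L + 4) *
          Real.exp (-(n * pr ^ 2 * ((1 - pr) / 2) ^ (L + 3 + (L + 3))))) := by
  have := isProbabilityMeasure_nodeLaw hp0 hp1
  set x := (n : ℝ) ^ (1 - α) with hx
  set ν := Measure.pi fun _ : Fin n => nodeLaw p with hν
  set ρ := Measure.infinitePi fun c : Crossing => poissonMeasure (relayIntensity pr n c) with hρ
  have hdens : ∀ l, 0 ≤ density p l := fun l => (density_pos hp0 hp1 l).le
  have hsum : ∑' s : Street, nodeLaw p s.carrier ≤ 1 := by
    simp_rw [nodeLaw_carrier]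
    exact (tsum_density hp0 hp1).le
  let E₁ : Set (Fin n → ℝ × ℝ) :=
    {ω | ∃ s : Street, L + 4 ≤ s.line.level ∧ ⌈x⌉₊ ≤ {i | ω i ∈ s.carrier}.ncard}
  let E₂ : Set (Fin n → ℝ × ℝ) :=
    {ω | ∃ s : Street, s.line.level = L ∧ N + 1 ≤ {i | ω i ∈ s.carrier}.ncard}
  let E₃ : Set (Fin n → ℝ × ℝ) :=
    {ω | ∃ x : Street × Fin (2 ^ L), True ∧ N + 1 ≤ {i | ω i ∈ x.1.point '' cell L x.2}.ncard}
  let E₄ : Set (Fin n → ℝ × ℝ) := ⋃ y : Bool × Fin (2 ^ L),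
    {ω | {i | ω i ∈ (⟨y.1, ⟨L, y.2⟩⟩ : Street).carrier}.ncard ≤ ⌊x⌋₊}
  let F : Set (Crossing → ℕ) :=
    {ω | ∃ c : Crossing, c.v.level ≤ L + 3 ∧ c.h.level ≤ L + 3 ∧ ω c = 0}
  have hsub : {ω : Config n | ¬ ShortPaths δ Pmax ω (powerBound δ Pmax α n) B} ⊆
      (E₁ ∪ E₂ ∪ E₃ ∪ E₄) ×ˢ Set.univ ∪ Set.univ ×ˢ F := by
    intro ω hω
    by_contra hcon
    simp only [Set.mem_union, Set.mem_prod, Set.mem_univ, and_true, true_and, not_or] at hcon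
    obtain ⟨⟨⟨⟨h₁, h₂⟩, h₃⟩, h₄⟩, h₅⟩ := hcon
    have hpow : ∀ s : Street, s.line.level = L →
        nominalPower δ Pmax ω s < powerBound δ Pmax α n := by
      rintro ⟨v, l, b⟩ rfl
      rw [nominalPower_lt_iff hδ hPmax hn]
      have : ¬ population ω ⟨v, ⟨l, b⟩⟩ ≤ ⌊x⌋₊ := fun h =>
        h₄ (Set.mem_iUnion.2 ⟨(v, b), h⟩)
      exact (Nat.floor_lt (by positivity)).1 (not_le.1 this)
    have hlev : ∀ s : Street, nominalPower δ Pmax ω s ≤ powerBound δ Pmax α n →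
        s.line.level ≤ L + 3 := by
      intro s hs
      rw [nominalPower_le_iff hδ hPmax hn] at hs
      by_contra hlt
      exact h₁ ⟨s, by omega, Nat.ceil_le.2 hs⟩
    have hpop : ∀ s : Street, s.line.level = L → population ω s ≤ N := fun s hs =>
      Nat.lt_succ_iff.1 (not_le.1 fun h => h₂ ⟨s, hs, h⟩)
    have hcell : ∀ (s : Street) (b : Fin (2 ^ L)), {i | ω.1 i ∈ s.point '' cell L b}.ncard ≤ N :=
      fun s b => Nat.lt_succ_iff.1 (not_le.1 fun h => h₃ ⟨(s, b), trivial, h⟩)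
    have hrel : ∀ c : Crossing, c.v.level ≤ L + 3 → c.h.level ≤ L + 3 → 1 ≤ ω.2 c :=
      fun c hv hh => Nat.one_le_iff_ne_zero.2 fun h => h₅ ⟨c, hv, hh, h⟩
    exact hω (shortPaths_of_regular
      ⟨fun s hs => (hpow s hs).le, hlev, hpop, hcell, hrel⟩
      ⟨hpow, fun s hs => hlev s hs.le, hpop, hcell, hrel⟩ (by push_cast; exact hB))
  have hE₁ : ν E₁ ≤ ENNReal.ofReal (2 * n * Real.exp (-(x / 10))) := by
    refine (pi_upper_tail_iUnion_exp (nodeLaw p) (fun s : Street => s.carrier)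
      (fun s => L + 4 ≤ s.line.level) (hdens (L + 4)) (fun s hs => ?_) hsum
      (Nat.ceil_pos.2 (by positivity)) (h_high.trans (Nat.le_ceil x))).trans ?_
    · rw [nodeLaw_carrier]
      exact ENNReal.ofReal_le_ofReal (density_anti hp0 hp1 hs)
    · refine ENNReal.ofReal_le_ofReal ?_
      gcongr
      exact Nat.le_ceil x
  have hexpN : 2 * n * Real.exp (-((N + 1 : ℕ) / 10)) ≤ 2 * n * Real.exp (-((N : ℝ) / 10)) := by
    gcongr
    simp
  have hN1 : (N : ℝ) ≤ (N + 1 : ℕ) := by simp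
  have hE₂ : ν E₂ ≤ ENNReal.ofReal (2 * n * Real.exp (-(N / 10))) := by
    refine (pi_upper_tail_iUnion_exp (nodeLaw p) (fun s : Street => s.carrier)
      (fun s => s.line.level = L) (hdens L) (fun s hs => ?_) hsum
      (Nat.succ_pos N) (h_pop.trans hN1)).trans (ENNReal.ofReal_le_ofReal hexpN)
    rw [nodeLaw_carrier, hs]
  have hE₃ : ν E₃ ≤ ENNReal.ofReal (2 * n * Real.exp (-(N / 10))) := by
    refine (pi_upper_tail_iUnion_exp (nodeLaw p)
      (fun y : Street × Fin (2 ^ L) => y.1.point '' cell L y.2) (fun _ => True)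
      (y := 1 / 2 ^ L) (by positivity) (fun y _ => ?_) (sum_cell_le hp0 hp1 L)
      (Nat.succ_pos N) (h_cell.trans hN1)).trans (ENNReal.ofReal_le_ofReal hexpN)
    rw [nodeLaw_cell, one_div, ENNReal.ofReal_inv_of_pos (by positivity),
      ENNReal.ofReal_pow zero_le_two, ENNReal.ofReal_ofNat]
    refine mul_le_of_le_one_left' (ENNReal.ofReal_le_one.2 ?_)
    refine (density_anti hp0 hp1 (Nat.zero_le _)).trans ?_
    simp only [density, pow_zero]
    linarith
  have hE₄ : ν E₄ ≤ ENNReal.ofReal (2 * 2 ^ L * Real.exp (x - n * density p L / 2)) := by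
    refine (measure_iUnion_fintype_le _ _).trans ((Finset.sum_le_card_nsmul _ _
      (ENNReal.ofReal (Real.exp (x - n * density p L / 2))) fun y _ => ?_).trans ?_)
    · refine (pi_lower_tail (nodeLaw p)
        (S := (⟨y.1, ⟨L, y.2⟩⟩ : Street).carrier)
        (Street.measurableSet_image_point _ measurableSet_Icc)
        (hdens L) (nodeLaw_carrier p _) n _).trans (ENNReal.ofReal_le_ofReal ?_)
      rw [sub_eq_add_neg, Real.exp_add]
      gcongr
      calc (2 : ℝ) ^ ⌊x⌋₊ ≤ Real.exp 1 ^ ⌊x⌋₊ := by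
            gcongr
            linarith [Real.add_one_le_exp 1]
        _ = Real.exp ⌊x⌋₊ := by rw [← Real.exp_nat_mul, mul_one]
        _ ≤ Real.exp x := Real.exp_le_exp.2 (Nat.floor_le (by positivity))
    · rw [nsmul_eq_mul, ← ENNReal.ofReal_natCast, ← ENNReal.ofReal_mul (by positivity)]
      simp
  have hF : ρ F ≤ ENNReal.ofReal (2 ^ (L + 4) * 2 ^ (L + 4) *
      Real.exp (-(n * pr ^ 2 * ((1 - pr) / 2) ^ (L + 3 + (L + 3))))) :=
    relays_missing_le hpr0 hpr1 n (L + 3)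
  calc networkLaw p pr n {ω | ¬ ShortPaths δ Pmax ω (powerBound δ Pmax α n) B}
      ≤ (ν.prod ρ) ((E₁ ∪ E₂ ∪ E₃ ∪ E₄) ×ˢ Set.univ ∪ Set.univ ×ˢ F) := measure_mono hsub
    _ ≤ ν (E₁ ∪ E₂ ∪ E₃ ∪ E₄) + ρ F := by
        refine (measure_union_le _ _).trans ?_
        rw [Measure.prod_prod, Measure.prod_prod, measure_univ, measure_univ, mul_one, one_mul]
    _ ≤ ν E₁ + ν E₂ + ν E₃ + ν E₄ + ρ F := by
        gcongr
        refine (measure_union_le _ _).trans ?_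
        gcongr
        refine (measure_union_le _ _).trans ?_
        gcongr
        exact measure_union_le _ _
    _ ≤ _ := by
        refine (add_le_add (add_le_add (add_le_add (add_le_add hE₁ hE₂) hE₃) hE₄) hF).trans ?_
        rw [← ENNReal.ofReal_add (by positivity) (by positivity),
          ← ENNReal.ofReal_add (by positivity) (by positivity),
          ← ENNReal.ofReal_add (by positivity) (by positivity),
          ← ENNReal.ofReal_add (by positivity) (by positivity)]
        exact ENNReal.ofReal_le_ofReal (by linarith)

/-- For `α ≤ 0` only a street holding all mobile nodes would be admissible. -/
theorem networkLaw_not_shortPaths_le_of_nonpos {p pr δ Pmax α B : ℝ} (hp0 : 0 < p) (hp1 : p < 1)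
    (hδ : 0 < δ) (hPmax : 0 < Pmax) (hα : α ≤ 0) {n : ℕ} (hn : 1 ≤ n) :
    networkLaw p pr (n + 1)
      {ω | ¬ ShortPaths δ Pmax ω (powerBound δ Pmax α (n + 1)) B} ≤
      ENNReal.ofReal ((p / 2) ^ n) := by
  have := isProbabilityMeasure_nodeLaw hp0 hp1
  have hn1 : (1 : ℝ) < ((n + 1 : ℕ) : ℝ) := by exact_mod_cast Nat.lt_succ_of_le hn
  have hx : 1 < ((n + 1 : ℕ) : ℝ) ^ (1 - α) := Real.one_lt_rpow hn1 (by linarith)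
  have hle : ((n + 1 : ℕ) : ℝ) ≤ ((n + 1 : ℕ) : ℝ) ^ (1 - α) := by
    simpa using Real.rpow_le_rpow_of_exponent_le hn1.le (show (1 : ℝ) ≤ 1 - α by linarith)
  let E : Set (Fin (n + 1) → ℝ × ℝ) :=
    {ω | ∃ s : Street, True ∧ n + 1 ≤ {i | ω i ∈ s.carrier}.ncard}
  have hsub : {ω : Config (n + 1) |
      ¬ ShortPaths δ Pmax ω (powerBound δ Pmax α (n + 1 : ℕ)) B} ⊆ E ×ˢ Set.univ := by
    intro ω hω
    by_contra hcon
    refine hω fun u hu => ?_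
    obtain ⟨s, -, hs⟩ := exists_street_of_mem_giantMax hu
    rw [nominalPower_le_iff hδ hPmax hx] at hs
    exact absurd ⟨⟨s, trivial, by exact_mod_cast hle.trans hs⟩, trivial⟩ hcon
  have hE := pi_upper_tail_iUnion (nodeLaw p) (fun s : Street => s.carrier) (fun _ => True)
    (y := ENNReal.ofReal (p / 2)) (fun s _ => by
      rw [nodeLaw_carrier]
      refine ENNReal.ofReal_le_ofReal ((density_anti hp0 hp1 (Nat.zero_le _)).trans ?_)
      simp [density])
    (by simp_rw [nodeLaw_carrier]; exact (tsum_density hp0 hp1).le) (n + 1) n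
  rw [Nat.choose_self, Nat.cast_one, one_mul, ← ENNReal.ofReal_pow (by positivity)] at hE
  refine (measure_mono hsub).trans ?_
  rw [networkLaw, Measure.prod_prod, measure_univ, mul_one]
  exact hE

/-! ### Choice of the level and asymptotics -/

lemma two_rpow_neg_dimNodes_sub_one {p : ℝ} (hp1 : p < 1) :
    (2 : ℝ) ^ (-(dimNodes p - 1)) = (1 - p) / 2 := by
  have hq : 0 < 1 - p := by linarith
  have h : (2 : ℝ) ^ dimNodes p = 4 / (1 - p) :=
    Real.rpow_logb two_pos (by norm_num) (by positivity)
  rw [neg_sub, Real.rpow_sub two_pos, h, Real.rpow_one]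
  field_simp
  norm_num

lemma two_rpow_neg_dimRelays {pr : ℝ} (hpr1 : pr < 1) :
    (2 : ℝ) ^ (-dimRelays pr) = ((1 - pr) / 2) ^ 2 := by
  have hq : 0 < 1 - pr := by linarith
  have h : (2 : ℝ) ^ (Real.log (2 / (1 - pr)) / Real.log 2) = 2 / (1 - pr) :=
    Real.rpow_logb two_pos (by norm_num) (by positivity)
  rw [dimRelays, Real.rpow_neg zero_le_two, mul_comm, Real.rpow_mul zero_le_two, h,
    Real.rpow_ofNat, ← inv_pow, inv_div]

lemma dimRelays_pos {pr : ℝ} (hpr0 : 0 < pr) (hpr1 : pr < 1) : 0 < dimRelays pr := by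
  have h1 : 1 < 2 / (1 - pr) := by
    rw [one_lt_div (by linarith)]; linarith
  have := Real.log_pos h1
  have := Real.log_pos (one_lt_two (α := ℝ))
  unfold dimRelays
  positivity

/-- A level `L` with `2 ^ (L * (dimNodes p - 1))` comparable to `n ^ α`: the streets of level `L`
carry on average between `8 * n ^ (1 - α)` and a constant times `n ^ (1 - α)` mobile nodes. -/
lemma exists_level {p pr α : ℝ} (hp0 : 0 < p) (hp1 : p < 1) (hpr0 : 0 < pr) (hpr1 : pr < 1)
    (hdF : 3 < dimNodes p) (hα0 : 0 < α) (hα : α < 1) {n : ℕ} (hn : 1 ≤ p / 16 * (n : ℝ) ^ α) :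
    ∃ L : ℕ, (2 : ℝ) ^ L ≤ n ∧ 8 * (n : ℝ) ^ (1 - α) ≤ n * density p L ∧
      n * density p L ≤ 8 * (2 / (1 - p)) * (n : ℝ) ^ (1 - α) ∧
      4 * (n * density p (L + 4)) ≤ (n : ℝ) ^ (1 - α) ∧
      n * (1 / 2 ^ L) ≤
        (p / 16 * ((1 - p) / 2)) ^ (-(1 / (dimNodes p - 1))) *
          (n : ℝ) ^ (1 - α / (dimNodes p - 1)) ∧
      (n : ℝ) ^ (1 - α * (dimRelays pr / (dimNodes p - 1))) ≤ n * ((1 - pr) / 2) ^ (2 * L) := by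
  set β := dimNodes p - 1 with hβ
  have hβ2 : 2 < β := by linarith
  have hg := two_rpow_neg_dimNodes_sub_one hp1
  rw [← hβ] at hg
  set g := (1 - p) / 2 with hgdef
  have hg0 : 0 < g := by rw [hgdef]; linarith
  have hg4 : g < 1 / 4 := by
    rw [← hg]
    calc (2 : ℝ) ^ (-β) < 2 ^ (-2 : ℝ) := Real.rpow_lt_rpow_of_exponent_lt one_lt_two (by linarith)
      _ = 1 / 4 := by rw [Real.rpow_neg zero_le_two, Real.rpow_ofNat]; norm_num
  have hn0 : 0 < (n : ℝ) := by
    rcases Nat.eq_zero_or_pos n with rfl | h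
    · rw [Nat.cast_zero, Real.zero_rpow hα0.ne', mul_zero] at hn
      linarith
    · exact_mod_cast h
  have hn1 : (1 : ℝ) ≤ n := by
    have : 0 < n := by exact_mod_cast hn0
    exact_mod_cast this
  set y := (n : ℝ) ^ α with hy
  have hy0 : 0 < y := by positivity
  have hyn : y ≤ n := by
    simpa using Real.rpow_le_rpow_of_exponent_le hn1 hα.le
  have hny : (n : ℝ) ^ (1 - α) = n / y := by rw [Real.rpow_sub hn0, Real.rpow_one]
  obtain ⟨L, hL1, hL2⟩ := exists_nat_pow_near_of_lt_one
    (show 0 < (p / 16 * y)⁻¹ by positivity) (inv_le_one_of_one_le₀ hn) hg0 (by linarith)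
  -- `G = g ^ L` is pinned between `1 / (c y)` and `1 / (g c y)`
  set G := g ^ L with hG
  have hG0 : 0 < G := by positivity
  have hGlow : 1 ≤ p / 16 * y * G := by
    rw [inv_le_iff_one_le_mul₀ (by positivity)] at hL2
    linarith
  have hGup : p / 16 * y * g * G ≤ 1 := by
    have h2 := mul_lt_mul_of_pos_left hL1 (show 0 < p / 16 * y by positivity)
    rw [mul_inv_cancel₀ (by positivity)] at h2
    rw [pow_succ, ← hG] at h2
    linarith
  have hG2 : G = (2 : ℝ) ^ (-(β * L)) := by
    rw [hG, ← hg, ← Real.rpow_mul_natCast zero_le_two, neg_mul]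
  have h2L : ((2 : ℝ) ^ L)⁻¹ = G ^ (1 / β) := by
    rw [hG2, ← Real.rpow_mul zero_le_two, ← Real.rpow_natCast, ← Real.rpow_neg zero_le_two]
    congr 1
    field_simp
  have hr : (((1 - pr) / 2) ^ (2 * L) : ℝ) = G ^ (dimRelays pr / β) := by
    rw [pow_mul, ← two_rpow_neg_dimRelays hpr1, hG2, ← Real.rpow_mul zero_le_two,
      ← Real.rpow_mul_natCast zero_le_two]
    congr 1
    field_simp
  have hdr0 := dimRelays_pos hpr0 hpr1
  have hd : ∀ l, density p l = p / 2 * g ^ l := fun l => rfl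
  refine ⟨L, ?_, ?_, ?_, ?_, ?_, ?_⟩
  · have h1 : (2 : ℝ) ^ L * G ≤ 1 := by
      rw [hG, ← mul_pow]
      exact pow_le_one₀ (by positivity) (by linarith)
    calc (2 : ℝ) ^ L ≤ 2 ^ L * (p / 16 * y * G) := le_mul_of_one_le_right (by positivity) hGlow
      _ = 2 ^ L * G * (p / 16 * y) := by ring
      _ ≤ 1 * (1 * n) := by gcongr; linarith
      _ = n := by ring
  · rw [hny, hd, ← hG, ← mul_div_assoc, div_le_iff₀ hy0]
    nlinarith
  · rw [hny, hd, ← hG, show 2 / (1 - p) = g⁻¹ by rw [hgdef, inv_div], ← mul_div_assoc,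
      le_div_iff₀ hy0, mul_assoc 8, mul_left_comm, inv_mul_eq_div, ← mul_div_assoc,
      le_div_iff₀ hg0]
    nlinarith
  · -- four levels further down, the density has lost more than a factor `4 ^ 4`
    rw [hny, hd, pow_add, ← hG, le_div_iff₀ hy0]
    have h3 : g ^ 3 ≤ 1 / 64 := by
      calc g ^ 3 ≤ (1 / 4) ^ 3 := by gcongr
        _ = 1 / 64 := by norm_num
    have h4 : p / 16 * y * g * G * g ^ 3 ≤ 1 * (1 / 64) := by gcongr
    have h5 : n * (p / 16 * y * g * G * g ^ 3) ≤ n * (1 * (1 / 64)) := by gcongr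
    linarith
  · have h1 : G ≤ (p / 16 * g * y)⁻¹ := by
      rw [← one_div, le_div_iff₀ (by positivity)]
      linarith
    have h2 : y ^ (-(1 / β)) = (n : ℝ) ^ (-(α / β)) := by
      rw [hy, ← Real.rpow_mul hn0.le]
      congr 1
      ring
    calc (n : ℝ) * (1 / 2 ^ L) = n * G ^ (1 / β) := by rw [one_div, h2L]
      _ ≤ n * ((p / 16 * g * y)⁻¹) ^ (1 / β) := by gcongr
      _ = (p / 16 * g) ^ (-(1 / β)) * (n : ℝ) ^ (1 - α / β) := by
          rw [Real.inv_rpow (by positivity), ← Real.rpow_neg (by positivity),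
            Real.mul_rpow (by positivity) hy0.le, h2, sub_eq_add_neg, Real.rpow_add hn0,
            Real.rpow_one]
          ring
  · have h1 : y⁻¹ ≤ G := by
      rw [inv_le_iff_one_le_mul₀ hy0]
      have : p / 16 * (y * G) ≤ 1 * (y * G) := by gcongr; linarith
      linarith
    calc (n : ℝ) ^ (1 - α * (dimRelays pr / β)) = n * (y⁻¹) ^ (dimRelays pr / β) := by
          rw [Real.inv_rpow hy0.le, hy, ← Real.rpow_mul hn0.le, sub_eq_add_neg,
            Real.rpow_add hn0, Real.rpow_one, Real.rpow_neg hn0.le]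
      _ ≤ n * ((1 - pr) / 2) ^ (2 * L) := by
          rw [hr]
          gcongr

lemma tendsto_pow_mul_exp_neg_mul_rpow {a b : ℝ} (ha : 0 < a) (hb : 0 < b) (j : ℕ) :
    Tendsto (fun n : ℕ => (n : ℝ) ^ j * Real.exp (-(a * (n : ℝ) ^ b))) atTop (𝓝 0) := by
  have h := (tendsto_rpow_mul_exp_neg_mul_atTop_nhds_zero (j / b) a ha).comp
    ((tendsto_rpow_atTop hb).comp tendsto_natCast_atTop_atTop)
  refine h.congr fun n => ?_
  simp only [Function.comp_apply]
  rw [← Real.rpow_mul n.cast_nonneg, mul_div_cancel₀ _ hb.ne', Real.rpow_natCast, neg_mul]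

/-- The right-hand side of `networkLaw_not_shortPaths_le` after the choice of the level. -/
noncomputable def failureBound (a K γ κ ε : ℝ) (n : ℕ) : ℝ :=
  2 * n * Real.exp (-((n : ℝ) ^ a / 10)) + 2 * (2 * n * Real.exp (-(K * (n : ℝ) ^ γ / 10))) +
    2 * n * Real.exp (-(3 * (n : ℝ) ^ a)) + 256 * n ^ 2 * Real.exp (-(κ * (n : ℝ) ^ ε))

lemma tendsto_failureBound {a K γ κ ε : ℝ} (ha : 0 < a) (hK : 0 < K) (hγ : 0 < γ) (hκ : 0 < κ)
    (hε : 0 < ε) : Tendsto (failureBound a K γ κ ε) atTop (𝓝 0) := by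
  have h1 := (tendsto_pow_mul_exp_neg_mul_rpow (a := 1 / 10) (by norm_num) ha 1).const_mul 2
  have h2 := (tendsto_pow_mul_exp_neg_mul_rpow (a := K / 10) (by positivity) hγ 1).const_mul 4
  have h3 := (tendsto_pow_mul_exp_neg_mul_rpow (a := 3) (by norm_num) ha 1).const_mul 2
  have h4 := (tendsto_pow_mul_exp_neg_mul_rpow hκ hε 2).const_mul 256
  have h := ((h1.add h2).add h3).add h4
  simp only [mul_zero, add_zero] at h
  refine h.congr fun n => ?_
  rw [failureBound, pow_one, one_div_mul_eq_div, div_mul_eq_mul_div]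
  ring

/-- The sublinear regime `0 < α < 1`. -/
lemma exists_bound_of_pos {p pr δ Pmax α : ℝ} (hp0 : 0 < p) (hp1 : p < 1) (hpr0 : 0 < pr)
    (hpr1 : pr < 1) (hdF : 3 < dimNodes p) (hdr : dimRelays pr < dimNodes p - 1)
    (hδ : 0 < δ) (hPmax : 0 < Pmax) (hα0 : 0 < α) (hα : α < 1) :
    ∃ C : ℝ, 0 < C ∧
      Tendsto (fun n : ℕ => networkLaw p pr n
          {ω | ¬ ShortPaths δ Pmax ω (powerBound δ Pmax α n)
            (C * (n : ℝ) ^ (1 - α / (dimNodes p - 1)))})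
        atTop (𝓝 0) := by
  set β := dimNodes p - 1 with hβ
  set γ := 1 - α / β with hγdef
  set ε := 1 - α * (dimRelays pr / β) with hεdef
  have hβ2 : 2 < β := by linarith
  have hαβ : α / β ≤ α := div_le_self hα0.le (by linarith)
  have hγ0 : 0 < γ := by linarith
  have hε0 : 0 < ε := by
    have h1 : dimRelays pr / β < 1 := (div_lt_one (by linarith)).2 hdr
    have h2 := dimRelays_pos hpr0 hpr1
    have h3 : α * (dimRelays pr / β) < 1 * 1 :=
      mul_lt_mul'' hα h1 hα0.le (by positivity)
    linarith
  set D := (p / 16 * ((1 - p) / 2)) ^ (-(1 / β)) with hD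
  have hq : 0 < 1 - p := by linarith
  have hqr : 0 < 1 - pr := by linarith
  have hD0 : 0 < D := by positivity
  set K := 4 * (D + 8 * (2 / (1 - p))) with hK
  have hK0 : 0 < K := by positivity
  set κ := pr ^ 2 * ((1 - pr) / 2) ^ 6 with hκ
  have hκ0 : 0 < κ := by positivity
  refine ⟨5 * (K + 2), by positivity, ?_⟩
  have hlim := ENNReal.tendsto_ofReal
    (tendsto_failureBound (sub_pos.2 hα) hK0 hγ0 hκ0 hε0)
  rw [ENNReal.ofReal_zero] at hlim
  refine tendsto_of_tendsto_of_tendsto_of_le_of_le' tendsto_const_nhds hlim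
    (.of_forall fun _ => zero_le) ?_
  have hlarge : ∀ᶠ n : ℕ in atTop, 1 ≤ p / 16 * (n : ℝ) ^ α :=
    (((tendsto_rpow_atTop hα0).comp tendsto_natCast_atTop_atTop).const_mul_atTop
      (by positivity : 0 < p / 16)).eventually_ge_atTop 1
  filter_upwards [hlarge, eventually_ge_atTop 2] with n hn hn2
  have hn1 : (1 : ℝ) < n := by exact_mod_cast hn2
  have hx1 : 1 < (n : ℝ) ^ (1 - α) := Real.one_lt_rpow hn1 (by linarith)
  have hxγ : (n : ℝ) ^ (1 - α) ≤ (n : ℝ) ^ γ :=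
    Real.rpow_le_rpow_of_exponent_le hn1.le (by linarith)
  obtain ⟨L, hLn, hlow, hup, hhigh, hcell, hrel⟩ :=
    exists_level hp0 hp1 hpr0 hpr1 hdF hα0 hα hn
  have hceil := Nat.le_ceil (K * (n : ℝ) ^ γ)
  have hceil' := Nat.ceil_lt_add_one (show 0 ≤ K * (n : ℝ) ^ γ by positivity)
  have hup' : n * density p L ≤ 8 * (2 / (1 - p)) * (n : ℝ) ^ γ :=
    hup.trans (by gcongr)
  have hKn : K * (n : ℝ) ^ γ = 4 * (D * (n : ℝ) ^ γ) + 4 * (8 * (2 / (1 - p)) * (n : ℝ) ^ γ) := by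
    rw [hK]; ring
  have hD' : 0 ≤ D * (n : ℝ) ^ γ := by positivity
  have hp' : 0 ≤ 8 * (2 / (1 - p)) * (n : ℝ) ^ γ := by positivity
  refine (networkLaw_not_shortPaths_le (L := L) (N := ⌈K * (n : ℝ) ^ γ⌉₊) hp0 hp1 hpr0 hpr1 hδ
    hPmax hx1 hhigh (by linarith) (by linarith) (by linarith)).trans (ENNReal.ofReal_le_ofReal ?_)
  have hL4 : (2 : ℝ) ^ (L + 4) ≤ 16 * n := by
    rw [pow_add]; linarith
  have hrel' : κ * (n : ℝ) ^ ε ≤ n * pr ^ 2 * ((1 - pr) / 2) ^ (L + 3 + (L + 3)) := by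
    rw [show L + 3 + (L + 3) = 6 + 2 * L by ring, pow_add]
    calc κ * (n : ℝ) ^ ε ≤ κ * (n * ((1 - pr) / 2) ^ (2 * L)) := by gcongr
      _ = _ := by rw [hκ]; ring
  rw [failureBound]
  refine add_le_add (add_le_add (add_le_add le_rfl ?_) ?_) ?_
  · gcongr
  · gcongr
    linarith
  · calc (2 : ℝ) ^ (L + 4) * 2 ^ (L + 4) *
          Real.exp (-(n * pr ^ 2 * ((1 - pr) / 2) ^ (L + 3 + (L + 3))))
        ≤ (16 * n) * (16 * n) * Real.exp (-(κ * (n : ℝ) ^ ε)) := by gcongr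
      _ = 256 * n ^ 2 * Real.exp (-(κ * (n : ℝ) ^ ε)) := by ring

end Hyperfractal

theorem mainTheorem2 (p pr δ Pmax α : ℝ) (hp0 : 0 < p) (hp1 : p < 1) (hpr0 : 0 < pr)
    (hpr1 : pr < 1) (hdF : 3 < Hyperfractal.dimNodes p)
    (hdr : Hyperfractal.dimRelays pr < Hyperfractal.dimNodes p - 1)
    (hδ : 2 ≤ δ) (hPmax : 0 < Pmax) (hα : α < 1) :
    ∃ C : ℝ, 0 < C ∧
      Tendsto (fun n : ℕ => Hyperfractal.networkLaw p pr n
          {ω | ¬ Hyperfractal.ShortPaths δ Pmax ω (Hyperfractal.powerBound δ Pmax α n)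
            (C * (n : ℝ) ^ (1 - α / (Hyperfractal.dimNodes p - 1)))})
        atTop (𝓝 0) := by
  rcases le_or_gt α 0 with h0 | h0
  · refine ⟨1, one_pos, (tendsto_add_atTop_iff_nat 1).1 ?_⟩
    have hlim := ENNReal.tendsto_ofReal (tendsto_pow_atTop_nhds_zero_of_lt_one
      (show 0 ≤ p / 2 by positivity) (by linarith))
    rw [ENNReal.ofReal_zero] at hlim
    refine tendsto_of_tendsto_of_tendsto_of_le_of_le' tendsto_const_nhds hlim
      (.of_forall fun _ => zero_le) ?_
    filter_upwards [eventually_ge_atTop 1] with n hn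
    exact Hyperfractal.networkLaw_not_shortPaths_le_of_nonpos hp0 hp1 (by linarith) hPmax h0 hn
  · exact Hyperfractal.exists_bound_of_pos hp0 hp1 hpr0 hpr1 hdF hdr (by linarith) hPmax h0 hα
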